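/- Let $a_+,a_->0$ and $a=(a_++a_-)/2$. Let $G(z)=G(a_+,a_-;z)$ be the hyperbolic gamma function, i.e. the meromorphic function on $\mathbb{C}$ that for $|\mathrm{Im}\,z|<a$ is given by $$G(z)=\exp\Big(i\int_0^\infty\frac{dy}{y}\Big(\frac{\sin 2yz}{2\sinh(a_+y)\sinh(a_-y)}-\frac{z}{a_+a_-y}\Big)\Big),$$ and that satisfies $G(z+ia_\delta/2)=2\cosh(\pi z/a_{-\delta})\,G(z-ia_\delta/2)$ for $\delta=+,-$; its poles are the points $-i(a+ma_++na_-)$ with integers $m,n\ge 0$. For $d\in\mathbb{C}$ and $v,w\in\mathbb{C}^4$ put $$\mathcal{S}_3(d;v,w)=\prod_{k,l=1}^4 G\big(v_k+w_l-\tfrac{i}{4}(a_++a_-)+d\big)\,G\big(v_k+w_l-\tfrac{i}{4}(a_++a_-)-d\big).$$ For $\delta=+,-$ let $c_\delta(z)=\cosh(\pi z/a_\delta)$, $s_\delta(z)=\sinh(\pi z/a_\delta)$, and let $A_{3,\delta}(x)=\sum_{m=1}^4A_{3,\delta}^{(m)}(x)$ be the analytic difference operator acting on meromorphic functions of $x\in\mathbb{C}^4$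 with $$A_{3,\delta}^{(1)}(x)=\frac{c_\delta(x_2-x_3)\,c_\delta(x_3-x_4)\,c_\delta(x_4-x_2)}{s_\delta(x_1-x_2)\,s_\delta(x_1-x_3)\,s_\delta(x_1-x_4)}\exp\Big(\frac{i a_{-\delta}}{4}\big(3\partial_{x_1}-\partial_{x_2}-\partial_{x_3}-\partial_{x_4}\big)\Big),$$ where the exponential denotes the shift $f(x_1,x_2,x_3,x_4)\mapsto f(x_1+\frac{3ia_{-\delta}}{4},x_2-\frac{ia_{-\delta}}{4},x_3-\frac{ia_{-\delta}}{4},x_4-\frac{ia_{-\delta}}{4})$, and with $A_{3,\delta}^{(2)},A_{3,\delta}^{(3)},A_{3,\delta}^{(4)}$ obtained from $A_{3,\delta}^{(1)}$ by cyclic permutation of the indices. Then, for every $d\in\mathbb{C}$, under the constraint $\sum_{j=1}^4v_j=\sum_{j=1}^4w_j=0$ the kernel identities $$A_{3,\delta}(v)\,\mathcal{S}_3(d;v,w)=A_{3,\delta}(w)\,\mathcal{S}_3(d;v,w),\qquad \delta=+,-,$$ hold as identities between meromorphic functions; explicitly, they hold at every such $(v,w)$ with $s_\delta(v_j-v_k)\ne0$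 and $s_\delta(w_j-w_k)\neq 0$ for all $j\ne k$, and such that no gamma function factor of the shifted kernel functions occurring on the two sides has a pole, that is, for no $k,l$ and neither choice of sign is $v_k+w_l-\frac{i}{4}(a_++a_-)-\frac{i}{4}a_{-\delta}\pm d$ a pole of $G$. -/

import Mathlib

noncomputable section

namespace A3Kernel

/-- The function `g(a₊, a₋; z)`, given on the strip `|Im z| < (a₊ + a₋) / 2` by the (there absolutely
convergent) integral
`∫₀^∞ (1/y) (sin (2 y z) / (2 sinh (a₊ y) sinh (a₋ y)) - z / (a₊ a₋ y)) dy`. -/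
def gammaPhase (aP aM : ℝ) (z : ℂ) : ℂ :=
  ∫ y in Set.Ioi (0 : ℝ),
    (1 / (y : ℂ)) *
      (Complex.sin (2 * y * z) / (2 * Complex.sinh (aP * y) * Complex.sinh (aM * y))
        - z / (aP * aM * y))

/-- The least number of steps of length `aM` that bring a point of height `t` below the
height `(aP + aM) / 2`; it is `0` iff `t < (aP + aM) / 2`. -/
def stepCount (aP aM t : ℝ) : ℕ := ⌊(t - (aP + aM) / 2) / aM + 1⌋₊

/-- The hyperbolic gamma function `G(a₊, a₋; z)`. On the strip `|Im z| < (a₊ + a₋) / 2` it is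
`exp (i g(a₊, a₋; z))`, see `hyperbolicGamma_eq_exp`; outside the strip it is the meromorphic
continuation, obtained from `G(z + i a₋ / 2) = 2 cosh (π z / a₊) G(z - i a₋ / 2)`.
(At a pole the second product vanishes and Lean assigns the value `0`.) -/
def hyperbolicGamma (aP aM : ℝ) (z : ℂ) : ℂ :=
  Complex.exp (Complex.I * gammaPhase aP aM
      (z - stepCount aP aM z.im * (Complex.I * aM) + stepCount aP aM (-z.im) * (Complex.I * aM)))
    * (∏ j ∈ Finset.range (stepCount aP aM z.im),
        2 * Complex.cosh (Real.pi * (z - (j + 1 / 2) * (Complex.I * aM)) / aP))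
    / (∏ j ∈ Finset.range (stepCount aP aM (-z.im)),
        2 * Complex.cosh (Real.pi * (z + (j + 1 / 2) * (Complex.I * aM)) / aP))

theorem stepCount_eq_zero {aP aM t : ℝ} (hM : 0 < aM) (ht : t < (aP + aM) / 2) :
    stepCount aP aM t = 0 := by
  have h : (t - (aP + aM) / 2) / aM < 0 := div_neg_of_neg_of_pos (by linarith) hM
  exact Nat.floor_eq_zero.2 (by linarith)

theorem hyperbolicGamma_eq_exp {aP aM : ℝ} (hM : 0 < aM) {z : ℂ}
    (hz : |z.im| < (aP + aM) / 2) :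
    hyperbolicGamma aP aM z = Complex.exp (Complex.I * gammaPhase aP aM z) := by
  have h := abs_lt.1 hz
  simp [hyperbolicGamma, stepCount_eq_zero hM h.2,
    stepCount_eq_zero (aP := aP) hM (t := -z.im) (by linarith)]

/-- The poles of `G(a₊, a₋; ·)`: the points `-i ((a₊ + a₋) / 2 + m a₊ + n a₋)`, `m, n ≥ 0`. -/
def hyperbolicGammaPoles (aP aM : ℝ) : Set ℂ :=
  {z | ∃ m n : ℕ, z = -Complex.I * ((aP + aM) / 2 + m * aP + n * aM)}

/-- The kernel function
`S₃(d; v, w) = ∏_{k,l} G(v_k + w_l - i(a₊ + a₋)/4 + d) G(v_k + w_l - i(a₊ + a₋)/4 - d)`. -/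
def kernelS3 (aP aM : ℝ) (d : ℂ) (v w : Fin 4 → ℂ) : ℂ :=
  ∏ k : Fin 4, ∏ l : Fin 4,
    hyperbolicGamma aP aM (v k + w l - Complex.I * (aP + aM) / 4 + d) *
      hyperbolicGamma aP aM (v k + w l - Complex.I * (aP + aM) / 4 - d)

/-- `c_δ(z) = cosh (π z / α)` with `α = a_δ`. -/
def cFun (α : ℝ) (z : ℂ) : ℂ := Complex.cosh (Real.pi * z / α)

/-- `s_δ(z) = sinh (π z / α)` with `α = a_δ`. -/
def sFun (α : ℝ) (z : ℂ) : ℂ := Complex.sinh (Real.pi * z / α)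

/-- The coefficient of the `m`-th summand of the difference operator; the indices `m + 1`, `m + 2`,
`m + 3` are taken modulo `4`, so that the four coefficients are cyclic permutations of
`c(x₁-x₂) c(x₂-x₃) c(x₃-x₁) / (s(x₀-x₁) s(x₀-x₂) s(x₀-x₃))`. -/
def coeffA3 (α : ℝ) (m : Fin 4) (x : Fin 4 → ℂ) : ℂ :=
  cFun α (x (m + 1) - x (m + 2)) * cFun α (x (m + 2) - x (m + 3)) * cFun α (x (m + 3) - x (m + 1)) /
    (sFun α (x m - x (m + 1)) * sFun α (x m - x (m + 2)) * sFun α (x m - x (m + 3)))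

/-- The point at which `exp ((i β / 4) (3 ∂_m - ∑_{j ≠ m} ∂_j)) f` evaluates `f`. -/
def shiftA3 (β : ℝ) (m : Fin 4) (x : Fin 4 → ℂ) : Fin 4 → ℂ :=
  fun j => if j = m then x j + 3 * (Complex.I * β / 4) else x j - Complex.I * β / 4

/-- The analytic difference operator with coefficient parameter `α` and shift parameter `β`.
`A_{3,+}` is `opA3 a₊ a₋` and `A_{3,-}` is `opA3 a₋ a₊`. -/
def opA3 (α β : ℝ) (f : (Fin 4 → ℂ) → ℂ) (x : Fin 4 → ℂ) : ℂ :=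
  ∑ m : Fin 4, coeffA3 α m x * f (shiftA3 β m x)

/-- The points `(v, w)` at which no factor of the two sides of the kernel identity for
`opA3 α β` is singular: the denominators of the coefficients do not vanish, and no argument of
the gamma function in a shifted kernel function is a pole. The shifted arguments are
`u - i β / 4` and `u + 3 i β / 4` with `u = v_k + w_l - i(a₊ + a₋)/4 ± d`; as `β` is `a₊` or `a₋`, the
second one can be a pole only if the first one is. -/
structure IsRegularPoint (aP aM α β : ℝ) (d : ℂ) (v w : Fin 4 → ℂ) : Prop where
  left_ne : ∀ j k : Fin 4, j ≠ k → sFun α (v j - v k) ≠ 0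
  right_ne : ∀ j k : Fin 4, j ≠ k → sFun α (w j - w k) ≠ 0
  not_pole_add : ∀ k l : Fin 4,
    v k + w l - Complex.I * (aP + aM) / 4 - Complex.I * β / 4 + d ∉ hyperbolicGammaPoles aP aM
  not_pole_sub : ∀ k l : Fin 4,
    v k + w l - Complex.I * (aP + aM) / 4 - Complex.I * β / 4 - d ∉ hyperbolicGammaPoles aP aM

end A3Kernel

end

/-!
Put `x j = exp (2π v_j / α)` and `y j = exp (2π w_j / α)`, so that `∏ x j = ∏ y j = 1`. By the
difference equation of `G`, the left-hand side is a product of gamma functions that is symmetric in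
`v` and `w`, times a sum `∑ ρ m * ∏ l, (1 + A * x m * y l) * (1 + B * x m * y l)` with `A * B = -1`
and weights `ρ m` rational in the nodes `x`. The moments of `ρ` satisfy a linear recursion of order
four; evaluating them turns the sum into an expression that is symmetric in `x` and `y`.

The difference equation with step `a₋` reduces to the increment of the phase over a period. Rescaled
to `a₊ = 1`, this increment has derivative `π tanh (π z)` by the partial fraction expansion of the
tangent, and the duplication formula for `sinh` fixes the constant. The equation with step `a₊` then
follows from the symmetry `G(a₊, a₋; z) = G(a₋, a₊; z)`, which is evident on the strip and extends
to the plane by the identity theorem and the reflection equation.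
-/

noncomputable section

namespace A3Kernel

section Rational

variable {K : Type*} [Field K]

/-- The first elementary symmetric polynomial in four variables. -/
def esym1 (x : Fin 4 → K) : K := x 0 + x 1 + x 2 + x 3

/-- The second elementary symmetric polynomial in four variables. -/
def esym2 (x : Fin 4 → K) : K :=
  x 0 * x 1 + x 0 * x 2 + x 0 * x 3 + x 1 * x 2 + x 1 * x 3 + x 2 * x 3

/-- The third elementary symmetric polynomial in four variables. -/
def esym3 (x : Fin 4 → K) : K :=
  x 0 * x 1 * x 2 + x 0 * x 1 * x 3 + x 0 * x 2 * x 3 + x 1 * x 2 * x 3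

/-- The coefficient of the `m`-th summand of the difference operator in multiplicative
coordinates, up to the factor `x m ^ 2`: see `coeffA3_eq_nodeWeight`. -/
def nodeWeight (x : Fin 4 → K) (m : Fin 4) : K :=
  (x (m + 1) + x (m + 2)) * (x (m + 2) + x (m + 3)) * (x (m + 3) + x (m + 1)) /
    ((x m - x (m + 1)) * (x m - x (m + 2)) * (x m - x (m + 3)))

/-- The moments of the weights `nodeWeight x m / x m ^ 2` at the nodes `x m`. -/
def nodeMoment (x : Fin 4 → K) (n : ℕ) : K := ∑ m, nodeWeight x m / x m ^ 2 * x m ^ n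

theorem sum_nodeWeight_mul {x : Fin 4 → K} (hx : Function.Injective x) (c₀ c₁ c₂ c₃ : K) :
    ∑ m, nodeWeight x m * (c₀ + c₁ * x m + c₂ * x m ^ 2 + c₃ * x m ^ 3) =
      c₁ * esym1 x - c₃ * esym3 x := by
  have hne {j k : Fin 4} (hjk : j ≠ k) : x j - x k ≠ 0 := sub_ne_zero.2 (hx.ne hjk)
  have h01 := hne (show (0 : Fin 4) ≠ 1 by decide)
  have h02 := hne (show (0 : Fin 4) ≠ 2 by decide)
  have h03 := hne (show (0 : Fin 4) ≠ 3 by decide)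
  have h12 := hne (show (1 : Fin 4) ≠ 2 by decide)
  have h13 := hne (show (1 : Fin 4) ≠ 3 by decide)
  have h23 := hne (show (2 : Fin 4) ≠ 3 by decide)
  simp only [Fin.sum_univ_four, nodeWeight, esym1, esym3, Fin.isValue, Fin.reduceAdd, zero_add]
  rw [← neg_sub (x 0) (x 1), ← neg_sub (x 0) (x 2), ← neg_sub (x 0) (x 3), ← neg_sub (x 1) (x 2),
    ← neg_sub (x 1) (x 3), ← neg_sub (x 2) (x 3)]
  field_simp
  ring

theorem pow_four_eq_of_prod_eq_one {x : Fin 4 → K} (hx : ∏ m, x m = 1) (m : Fin 4) :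
    x m ^ 4 = esym1 x * x m ^ 3 - esym2 x * x m ^ 2 + esym3 x * x m - 1 := by
  rw [Fin.prod_univ_four] at hx
  fin_cases m <;> simp only [esym1, esym2, esym3, Fin.reduceFinMk] <;> linear_combination -hx

theorem nodeMoment_add_four {x : Fin 4 → K} (hx : ∏ m, x m = 1) (n : ℕ) :
    nodeMoment x (n + 4) = esym1 x * nodeMoment x (n + 3) - esym2 x * nodeMoment x (n + 2) +
      esym3 x * nodeMoment x (n + 1) - nodeMoment x n := by
  simp only [nodeMoment, Finset.mul_sum, ← Finset.sum_sub_distrib, ← Finset.sum_add_distrib]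
  refine Finset.sum_congr rfl fun m _ => ?_
  linear_combination nodeWeight x m / x m ^ 2 * x m ^ n * pow_four_eq_of_prod_eq_one hx m

theorem nodeMoment_add_two {x : Fin 4 → K} (hx : ∏ m, x m = 1) (n : ℕ) :
    nodeMoment x (n + 2) = ∑ m, nodeWeight x m * x m ^ n := by
  refine Finset.sum_congr rfl fun m _ => ?_
  have : x m ≠ 0 := Finset.prod_ne_zero_iff.1 (hx ▸ one_ne_zero) m (Finset.mem_univ m)
  rw [pow_add]
  field_simp

theorem nodeMoment_two_to_five {x : Fin 4 → K} (hinj : Function.Injective x)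
    (hx : ∏ m, x m = 1) :
    nodeMoment x 2 = 0 ∧ nodeMoment x 3 = esym1 x ∧ nodeMoment x 4 = 0 ∧
      nodeMoment x 5 = -esym3 x := by
  refine ⟨?_, ?_, ?_, ?_⟩
  · simpa [nodeMoment_add_two hx 0] using sum_nodeWeight_mul hinj 1 0 0 0
  · simpa [nodeMoment_add_two hx 1] using sum_nodeWeight_mul hinj 0 1 0 0
  · simpa [nodeMoment_add_two hx 2] using sum_nodeWeight_mul hinj 0 0 1 0
  · simpa [nodeMoment_add_two hx 3] using sum_nodeWeight_mul hinj 0 0 0 1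

theorem sum_nodeWeight_div_sq_mul {x : Fin 4 → K} (hinj : Function.Injective x)
    (hx : ∏ m, x m = 1) (p₁ p₂ p₃ p₄ p₅ p₆ p₇ : K) :
    ∑ m, nodeWeight x m / x m ^ 2 * (1 + p₁ * x m + p₂ * x m ^ 2 + p₃ * x m ^ 3 + p₄ * x m ^ 4 +
        p₅ * x m ^ 5 + p₆ * x m ^ 6 + p₇ * x m ^ 7 + x m ^ 8) =
      (esym3 x - esym1 x * esym2 x) * p₁ + esym1 x * p₃ - esym3 x * p₅ +
        (esym2 x * esym3 x - esym1 x) * p₇ := by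
  obtain ⟨h2, h3, h4, h5⟩ := nodeMoment_two_to_five hinj hx
  have rec0 := nodeMoment_add_four hx 0
  have rec1 := nodeMoment_add_four hx 1
  have rec2 := nodeMoment_add_four hx 2
  have rec3 := nodeMoment_add_four hx 3
  have rec4 := nodeMoment_add_four hx 4
  simp only [Nat.reduceAdd, zero_add, h2, h3, h4, h5] at rec0 rec1 rec2 rec3 rec4
  have hexpand : ∑ m, nodeWeight x m / x m ^ 2 * (1 + p₁ * x m + p₂ * x m ^ 2 + p₃ * x m ^ 3 +
      p₄ * x m ^ 4 + p₅ * x m ^ 5 + p₆ * x m ^ 6 + p₇ * x m ^ 7 + x m ^ 8) =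
      nodeMoment x 0 + p₁ * nodeMoment x 1 + p₂ * nodeMoment x 2 + p₃ * nodeMoment x 3 +
        p₄ * nodeMoment x 4 + p₅ * nodeMoment x 5 + p₆ * nodeMoment x 6 + p₇ * nodeMoment x 7 +
        nodeMoment x 8 := by
    simp only [nodeMoment, Finset.mul_sum, ← Finset.sum_add_distrib]
    exact Finset.sum_congr rfl fun m _ => by ring
  have h1 : nodeMoment x 1 = esym3 x - esym1 x * esym2 x := by linear_combination rec1
  have h6 : nodeMoment x 6 = 0 := by linear_combination rec2
  have h7 : nodeMoment x 7 = esym2 x * esym3 x - esym1 x := by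
    linear_combination rec3 + esym1 x * h6
  have h08 : nodeMoment x 0 + nodeMoment x 8 = 0 := by
    linear_combination rec4 + rec0 + esym3 x * h1 + esym1 x * h7 - esym2 x * h6
  rw [hexpand, h1, h2, h3, h4, h5, h6, h7]
  linear_combination h08

theorem prod_one_add_mul {w : Fin 4 → K} (hw : ∏ l, w l = 1) (t : K) :
    ∏ l, (1 + t * w l) = 1 + esym1 w * t + esym2 w * t ^ 2 + esym3 w * t ^ 3 + t ^ 4 := by
  rw [Fin.prod_univ_four] at hw ⊢
  simp only [esym1, esym2, esym3]
  linear_combination t ^ 4 * hw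

theorem quartic_mul_quartic {A B : K} (hAB : A * B = -1) (e₁ e₂ e₃ t : K) :
    (1 + e₁ * (A * t) + e₂ * (A * t) ^ 2 + e₃ * (A * t) ^ 3 + (A * t) ^ 4) *
        (1 + e₁ * (B * t) + e₂ * (B * t) ^ 2 + e₃ * (B * t) ^ 3 + (B * t) ^ 4) =
      1 + e₁ * (A + B) * t + (e₂ * ((A + B) ^ 2 + 2) - e₁ ^ 2) * t ^ 2 +
        (e₃ * ((A + B) ^ 3 + 3 * (A + B)) - e₁ * e₂ * (A + B)) * t ^ 3 +
        ((A + B) ^ 4 + 4 * (A + B) ^ 2 + 2 - e₁ * e₃ * ((A + B) ^ 2 + 2) + e₂ ^ 2) * t ^ 4 +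
        (e₂ * e₃ * (A + B) - e₁ * ((A + B) ^ 3 + 3 * (A + B))) * t ^ 5 +
        (e₂ * ((A + B) ^ 2 + 2) - e₃ ^ 2) * t ^ 6 + -(e₃ * (A + B)) * t ^ 7 + t ^ 8 := by
  have hA : A ≠ 0 := by rintro rfl; simp at hAB
  obtain rfl : B = -A⁻¹ := by field_simp; linear_combination hAB
  field_simp
  ring

theorem sum_nodeWeight_div_sq_mul_prod {x w : Fin 4 → K} (hinj : Function.Injective x)
    (hx : ∏ m, x m = 1) (hw : ∏ l, w l = 1) {A B : K} (hAB : A * B = -1) :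
    ∑ m, nodeWeight x m / x m ^ 2 * ∏ l, (1 + A * x m * w l) * (1 + B * x m * w l) =
      (A + B) * ((4 + (A + B) ^ 2) * (esym1 x * esym3 w + esym1 w * esym3 x) -
        (esym2 x + esym2 w) * (esym1 x * esym1 w + esym3 x * esym3 w)) := by
  simp only [Finset.prod_mul_distrib, prod_one_add_mul hw, quartic_mul_quartic hAB]
  rw [sum_nodeWeight_div_sq_mul hinj hx]
  ring

end Rational

open Complex

section Hyperbolic

variable {α : ℝ}

/-- The multiplicative coordinate `exp (2πz / α)`, in which the coefficients `coeffA3` are rational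
functions. -/
def expVar (α : ℝ) (z : ℂ) : ℂ := exp (2 * Real.pi * z / α)

theorem expVar_ne_zero (α : ℝ) (z : ℂ) : expVar α z ≠ 0 := exp_ne_zero _

theorem expVar_add (α : ℝ) (z w : ℂ) : expVar α (z + w) = expVar α z * expVar α w := by
  rw [expVar, mul_add, add_div, exp_add, expVar, expVar]

theorem prod_expVar_eq_one (α : ℝ) {v : Fin 4 → ℂ} (hv : ∑ j, v j = 0) :
    ∏ j, expVar α (v j) = 1 := by
  simp only [expVar, ← exp_sum, ← Finset.sum_div, ← Finset.mul_sum, hv, mul_zero, zero_div,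
    exp_zero]

theorem cFun_sub (α : ℝ) (a b : ℂ) :
    cFun α (a - b) = (expVar α a + expVar α b) * exp (-(Real.pi * (a + b) / α)) / 2 := by
  rw [cFun, cosh, expVar, expVar, add_mul, ← exp_add, ← exp_add]
  ring_nf

theorem sFun_sub (α : ℝ) (a b : ℂ) :
    sFun α (a - b) = (expVar α a - expVar α b) * exp (-(Real.pi * (a + b) / α)) / 2 := by
  rw [sFun, sinh, expVar, expVar, sub_mul, ← exp_add, ← exp_add]
  ring_nf

theorem expVar_injective_of_sFun_ne_zero {v : Fin 4 → ℂ}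
    (hv : ∀ j k, j ≠ k → sFun α (v j - v k) ≠ 0) : Function.Injective fun j => expVar α (v j) := by
  intro j k hjk
  by_contra hne
  exact hv j k hne (by rw [sFun_sub, sub_eq_zero.2 hjk, zero_mul, zero_div])

theorem coeffA3_eq_nodeWeight (α : ℝ) {v : Fin 4 → ℂ} (hv : ∑ j, v j = 0) (m : Fin 4) :
    coeffA3 α m v = nodeWeight (fun j => expVar α (v j)) m * expVar α (v m) ^ 2 := by
  have hsum : v m + v (m + 1) + v (m + 2) + v (m + 3) = 0 := by
    rw [← hv, Fin.sum_univ_four]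
    fin_cases m <;> simp only [Fin.reduceFinMk, Fin.reduceAdd, Fin.isValue] <;> ring
  have hnum : exp (-(Real.pi * (v (m + 1) + v (m + 2)) / α)) *
      exp (-(Real.pi * (v (m + 2) + v (m + 3)) / α)) *
      exp (-(Real.pi * (v (m + 3) + v (m + 1)) / α)) = expVar α (v m) := by
    rw [← exp_add, ← exp_add, expVar]
    congr 1
    linear_combination (-(2 * Real.pi) / α : ℂ) * hsum
  have hden : exp (-(Real.pi * (v m + v (m + 1)) / α)) *
      exp (-(Real.pi * (v m + v (m + 2)) / α)) *
      exp (-(Real.pi * (v m + v (m + 3)) / α)) = (expVar α (v m))⁻¹ := by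
    rw [← exp_add, ← exp_add, expVar, ← exp_neg]
    congr 1
    linear_combination (-Real.pi / α : ℂ) * hsum
  have hratio (a₁ a₂ a₃ b₁ b₂ b₃ p₁ p₂ p₃ q₁ q₂ q₃ : ℂ) :
      a₁ * p₁ / 2 * (a₂ * p₂ / 2) * (a₃ * p₃ / 2) / (b₁ * q₁ / 2 * (b₂ * q₂ / 2) * (b₃ * q₃ / 2)) =
        a₁ * a₂ * a₃ / (b₁ * b₂ * b₃) * (p₁ * p₂ * p₃ / (q₁ * q₂ * q₃)) := by ring
  simp only [coeffA3, nodeWeight, cFun_sub, sFun_sub, hratio]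
  rw [hnum, hden, div_inv_eq_mul, sq]

/-- The factor `2 cosh(π(z - iα/4 + d)/α) · 2 cosh(π(z - iα/4 - d)/α)` that a pair of gamma
functions in the kernel function picks up under a shift. -/
def stepFactor (α : ℝ) (d z : ℂ) : ℂ :=
  2 * cosh (Real.pi * (z - I * α / 4 + d) / α) * (2 * cosh (Real.pi * (z - I * α / 4 - d) / α))

theorem two_mul_cosh (θ : ℂ) : 2 * cosh θ = exp (-θ) * (1 + exp (2 * θ)) := by
  rw [two_cosh, mul_add, ← exp_add]
  ring_nf

theorem stepFactor_eq (hα : α ≠ 0) (d z : ℂ) :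
    stepFactor α d z = I / expVar α z *
      ((1 + -I * expVar α d * expVar α z) * (1 + -I * (expVar α d)⁻¹ * expVar α z)) := by
  have hα' : (α : ℂ) ≠ 0 := by exact_mod_cast hα
  have hsq (c : ℂ) : exp (2 * (Real.pi * (z - I * α / 4 + c) / α)) =
      -I * expVar α c * expVar α z := by
    have hI : -I = exp (-(Real.pi / 2 * I)) := by rw [exp_neg, exp_pi_div_two_mul_I, inv_I]
    rw [hI, expVar, expVar, ← exp_add, ← exp_add]
    congr 1
    field_simp
    ring
  have hprod : exp (-(Real.pi * (z - I * α / 4 + d) / α)) *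
      exp (-(Real.pi * (z - I * α / 4 + -d) / α)) = I / expVar α z := by
    rw [expVar, ← exp_add]
    nth_rw 3 [← exp_pi_div_two_mul_I]
    rw [← exp_sub]
    congr 1
    field_simp
    ring
  have hneg : expVar α (-d) = (expVar α d)⁻¹ := by
    rw [expVar, expVar, ← exp_neg, mul_neg, neg_div]
  rw [stepFactor, sub_eq_add_neg _ d, two_mul_cosh, two_mul_cosh, hsq, hsq, hneg, ← hprod]
  ring

theorem prod_stepFactor (hα : α ≠ 0) (d z : ℂ) {w : Fin 4 → ℂ} (hw : ∑ l, w l = 0) :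
    ∏ l, stepFactor α d (z + w l) = (expVar α z ^ 4)⁻¹ *
      ∏ l, (1 + -I * expVar α d * expVar α z * expVar α (w l)) *
        (1 + -I * (expVar α d)⁻¹ * expVar α z * expVar α (w l)) := by
  have hprefactor : ∏ l, I / (expVar α z * expVar α (w l)) = (expVar α z ^ 4)⁻¹ := by
    simp [Finset.prod_div_distrib, Finset.prod_mul_distrib, prod_expVar_eq_one α hw]
  simp only [stepFactor_eq hα, expVar_add, ← hprefactor, ← Finset.prod_mul_distrib, mul_assoc]

theorem sum_coeffA3_mul_prod_stepFactor (hα : α ≠ 0) (d : ℂ) {v w : Fin 4 → ℂ}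
    (hv : ∑ j, v j = 0) (hw : ∑ j, w j = 0) :
    ∑ m, coeffA3 α m v * ∏ l, stepFactor α d (v m + w l) =
      ∑ m, nodeWeight (fun j => expVar α (v j)) m / expVar α (v m) ^ 2 *
        ∏ l, (1 + -I * expVar α d * expVar α (v m) * expVar α (w l)) *
          (1 + -I * (expVar α d)⁻¹ * expVar α (v m) * expVar α (w l)) := by
  refine Finset.sum_congr rfl fun m _ => ?_
  have := expVar_ne_zero α (v m)
  rw [coeffA3_eq_nodeWeight α hv, prod_stepFactor hα d _ hw]
  field_simp

theorem sum_coeffA3_mul_prod_stepFactor_comm (hα : α ≠ 0) (d : ℂ) {v w : Fin 4 → ℂ}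
    (hv : ∑ j, v j = 0) (hw : ∑ j, w j = 0) (hvne : ∀ j k, j ≠ k → sFun α (v j - v k) ≠ 0)
    (hwne : ∀ j k, j ≠ k → sFun α (w j - w k) ≠ 0) :
    ∑ m, coeffA3 α m v * ∏ l, stepFactor α d (v m + w l) =
      ∑ m, coeffA3 α m w * ∏ l, stepFactor α d (w m + v l) := by
  have hAB : -I * expVar α d * (-I * (expVar α d)⁻¹) = -1 := by
    have := expVar_ne_zero α d
    field_simp
    exact I_sq
  have hrational {x y : Fin 4 → ℂ} (hx : ∑ j, x j = 0) (hy : ∑ j, y j = 0)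
      (hne : ∀ j k, j ≠ k → sFun α (x j - x k) ≠ 0) := sum_nodeWeight_div_sq_mul_prod
    (expVar_injective_of_sFun_ne_zero hne) (prod_expVar_eq_one α hx) (prod_expVar_eq_one α hy) hAB
  rw [sum_coeffA3_mul_prod_stepFactor hα d hv hw,
    sum_coeffA3_mul_prod_stepFactor hα d hw hv, hrational hv hw hvne, hrational hw hv hwne]
  ring

end Hyperbolic

section DifferenceOperator

theorem opA3_prod_prod {β : ℝ} {F C : ℂ → ℂ} (α : ℝ) {v w : Fin 4 → ℂ}
    (hF : ∀ k l, F (v k + w l + 3 * (I * β / 4)) = C (v k + w l) * F (v k + w l - I * β / 4)) :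
    opA3 α β (fun x => ∏ k, ∏ l, F (x k + w l)) v =
      (∑ m, coeffA3 α m v * ∏ l, C (v m + w l)) * ∏ k, ∏ l, F (v k + w l - I * β / 4) := by
  have hshift (m k : Fin 4) : ∏ l, F (shiftA3 β m v k + w l) =
      (if k = m then ∏ l, C (v m + w l) else 1) * ∏ l, F (v k + w l - I * β / 4) := by
    rcases eq_or_ne k m with rfl | hkm
    · simp only [shiftA3, if_true, ← Finset.prod_mul_distrib, ← hF, add_right_comm]
    · simp only [shiftA3, if_neg hkm, one_mul, sub_add_eq_add_sub]
  simp only [opA3, hshift, Finset.prod_mul_distrib, Finset.prod_ite_eq', Finset.mem_univ, if_true,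
    Finset.sum_mul, mul_assoc]

theorem opA3_prod_prod_eq {α β : ℝ} (hα : α ≠ 0) {d : ℂ} {F : ℂ → ℂ} {v w : Fin 4 → ℂ}
    (hv : ∑ j, v j = 0) (hw : ∑ j, w j = 0) (hvne : ∀ j k, j ≠ k → sFun α (v j - v k) ≠ 0)
    (hwne : ∀ j k, j ≠ k → sFun α (w j - w k) ≠ 0)
    (hF : ∀ k l, F (v k + w l + 3 * (I * β / 4)) =
      stepFactor α d (v k + w l) * F (v k + w l - I * β / 4)) :
    opA3 α β (fun x => ∏ k, ∏ l, F (x k + w l)) v =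
      opA3 α β (fun x => ∏ k, ∏ l, F (v k + x l)) w := by
  have hcomm : (fun x : Fin 4 → ℂ => ∏ k, ∏ l, F (v k + x l)) =
      fun x => ∏ k, ∏ l, F (x k + v l) := by
    funext x
    rw [Finset.prod_comm]
    simp only [add_comm]
  have hF' (k l : Fin 4) : F (w k + v l + 3 * (I * β / 4)) =
      stepFactor α d (w k + v l) * F (w k + v l - I * β / 4) := by
    rw [add_comm (w k)]
    exact hF l k
  rw [hcomm, opA3_prod_prod α hF, opA3_prod_prod α hF',
    sum_coeffA3_mul_prod_stepFactor_comm hα d hv hw hvne hwne, Finset.prod_comm]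
  simp only [add_comm]

end DifferenceOperator

open MeasureTheory Set Filter Topology

section Estimates

theorem norm_cos_le_cosh (w : ℂ) : ‖cos w‖ ≤ Real.cosh w.im := by
  rw [cos, norm_div, Complex.norm_ofNat, Real.cosh_eq]
  gcongr
  refine (norm_add_le _ _).trans_eq ?_
  simp [norm_exp, add_comm]

theorem norm_sin_le (w : ℂ) : ‖sin w‖ ≤ ‖w‖ * Real.cosh w.im := by
  have hconvex : Convex ℝ {u : ℂ | |u.im| ≤ |w.im|} := by
    simp only [abs_le]
    exact (convex_Icc (-|w.im|) |w.im|).linear_preimage imLm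
  have hbound (u : ℂ) (hu : u ∈ {u : ℂ | |u.im| ≤ |w.im|}) : ‖cos u‖ ≤ Real.cosh w.im :=
    (norm_cos_le_cosh u).trans (Real.cosh_le_cosh.2 hu)
  simpa [mul_comm] using hconvex.norm_image_sub_le_of_norm_hasDerivWithin_le
    (fun u _ => (hasDerivAt_sin u).hasDerivWithinAt) hbound (x := 0) (by simp) (by simp : w ∈ _)

theorem norm_cos_sub_one_le (w : ℂ) : ‖cos w - 1‖ ≤ ‖w‖ ^ 2 / 2 * Real.exp |w.im| := by
  have hcos : cos w - 1 = -2 * sin (w / 2) ^ 2 := by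
    have := cos_two_mul' (w / 2)
    rw [mul_div_cancel₀ w two_ne_zero, cos_sq'] at this
    linear_combination this
  have hcosh : Real.cosh (w.im / 2) ^ 2 ≤ Real.exp |w.im| := by
    calc Real.cosh (w.im / 2) ^ 2 ≤ Real.exp |w.im / 2| ^ 2 := by
          gcongr
          rw [← Real.cosh_abs, Real.cosh_eq]
          linarith [Real.exp_le_exp.2 (neg_le_self (abs_nonneg (w.im / 2)))]
      _ = Real.exp |w.im| := by
          rw [← Real.exp_nat_mul, abs_div, abs_two]
          ring_nf
  calc ‖cos w - 1‖ = 2 * ‖sin (w / 2)‖ ^ 2 := by simp [hcos]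
    _ ≤ 2 * (‖w / 2‖ * Real.cosh (w.im / 2)) ^ 2 := by
        gcongr
        simpa using norm_sin_le (w / 2)
    _ = ‖w‖ ^ 2 / 2 * Real.cosh (w.im / 2) ^ 2 := by
        rw [norm_div, Complex.norm_ofNat]
        ring
    _ ≤ ‖w‖ ^ 2 / 2 * Real.exp |w.im| := by gcongr

theorem sinh_le_mul_cosh {p : ℝ} (hp : 0 ≤ p) : Real.sinh p ≤ p * Real.cosh p := by
  simpa [sin_mul_I, ← ofReal_sinh, abs_of_nonneg hp, abs_of_nonneg (Real.sinh_nonneg_iff.2 hp)]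
    using norm_sin_le (p * I)

theorem inv_sinh_le {p : ℝ} (hp : 0 < p) :
    (Real.sinh p)⁻¹ ≤ p⁻¹ * ((1 + 2 * p) * Real.exp (-p)) := by
  have hexp : (1 + 2 * p) * Real.exp (-p) ≤ Real.exp p := by
    rw [Real.exp_neg, ← div_eq_mul_inv, div_le_iff₀ (Real.exp_pos p), ← Real.exp_add]
    linarith [Real.add_one_le_exp (p + p)]
  rw [inv_le_iff_one_le_mul₀ (Real.sinh_pos_iff.2 hp), mul_assoc, le_inv_mul_iff₀ hp, Real.sinh_eq]
  have hmul : Real.exp p * Real.exp (-p) = 1 := by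
    rw [← Real.exp_add, add_neg_cancel, Real.exp_zero]
  nlinarith [mul_le_mul_of_nonneg_right hexp (Real.exp_nonneg (-p))]

theorem one_sub_div_sinh_le {p : ℝ} (hp : 0 < p) :
    1 - p / Real.sinh p ≤ 2 * p ^ 2 * (1 + p ^ 2)⁻¹ := by
  have hsinh : 0 < Real.sinh p := Real.sinh_pos_iff.2 hp
  have hsmall : 1 - p / Real.sinh p ≤ p ^ 2 / 2 := by
    have : Real.sinh p ≤ p * Real.exp (p ^ 2 / 2) := (sinh_le_mul_cosh hp.le).trans
      (mul_le_mul_of_nonneg_left (Real.cosh_le_exp_half_sq p) hp.le)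
    calc 1 - p / Real.sinh p ≤ 1 - Real.exp (-(p ^ 2 / 2)) := by
          gcongr
          rw [le_div_iff₀ hsinh, Real.exp_neg, inv_mul_le_iff₀ (Real.exp_pos _)]
          linarith
      _ ≤ p ^ 2 / 2 := by linarith [Real.add_one_le_exp (-(p ^ 2 / 2))]
  have hlarge : 1 - p / Real.sinh p ≤ 1 := sub_le_self _ (by positivity)
  rw [← div_eq_mul_inv, le_div_iff₀ (by positivity)]
  nlinarith [mul_le_mul_of_nonneg_right hlarge (sq_nonneg p)]

theorem abs_inv_sinh_mul_sinh_sub_le {p q : ℝ} (hp : 0 < p) (hq : 0 < q) :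
    |(Real.sinh p * Real.sinh q)⁻¹ - (p * q)⁻¹| ≤
      2 * (p / q) * (1 + p ^ 2)⁻¹ + 2 * (q / p) * (1 + q ^ 2)⁻¹ := by
  have hsp : 0 < Real.sinh p := Real.sinh_pos_iff.2 hp
  have hsq : 0 < Real.sinh q := Real.sinh_pos_iff.2 hq
  have hp1 : p / Real.sinh p ≤ 1 := (div_le_one hsp).2 (Real.self_le_sinh_iff.2 hp.le)
  have hq1 : q / Real.sinh q ≤ 1 := (div_le_one hsq).2 (Real.self_le_sinh_iff.2 hq.le)
  have hfactor : (p * q)⁻¹ - (Real.sinh p * Real.sinh q)⁻¹ =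
      (p * q)⁻¹ * (1 - p / Real.sinh p * (q / Real.sinh q)) := by
    field_simp
  have hle : 1 - p / Real.sinh p * (q / Real.sinh q) ≤
      2 * p ^ 2 * (1 + p ^ 2)⁻¹ + 2 * q ^ 2 * (1 + q ^ 2)⁻¹ := by
    have : 0 < p / Real.sinh p := by positivity
    nlinarith [one_sub_div_sinh_le hp, one_sub_div_sinh_le hq]
  rw [abs_sub_comm, hfactor, abs_of_nonneg
    (mul_nonneg (by positivity) (sub_nonneg.2 (mul_le_one₀ hp1 (by positivity) hq1)))]
  calc _ ≤ (p * q)⁻¹ * (2 * p ^ 2 * (1 + p ^ 2)⁻¹ + 2 * q ^ 2 * (1 + q ^ 2)⁻¹) := by gcongr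
    _ = _ := by field_simp

end Estimates

section GammaPhase

theorem eventually_abs_im_lt {z : ℂ} {b : ℝ} (hz : |z.im| < b) : ∀ᶠ u in 𝓝 z, |u.im| < b :=
  continuous_im.abs.continuousAt.eventually_lt_const hz

/-- The integrand of `gammaPhase`. -/
def gammaIntegrand (aP aM : ℝ) (z : ℂ) (y : ℝ) : ℂ :=
  (1 / (y : ℂ)) * (sin (2 * y * z) / (2 * sinh (aP * y) * sinh (aM * y)) - z / (aP * aM * y))

/-- The derivative of `gammaIntegrand` in the complex variable. -/
def gammaIntegrandDeriv (aP aM : ℝ) (z : ℂ) (y : ℝ) : ℂ :=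
  cos (2 * y * z) / (sinh (aP * y) * sinh (aM * y)) - 1 / (aP * aM * y ^ 2)

theorem gammaPhase_comm (aP aM : ℝ) (z : ℂ) : gammaPhase aP aM z = gammaPhase aM aP z := by
  rw [gammaPhase, gammaPhase]
  congr 1 with y
  ring

theorem gammaPhase_neg (aP aM : ℝ) (z : ℂ) : gammaPhase aP aM (-z) = -gammaPhase aP aM z := by
  rw [gammaPhase, gammaPhase, ← integral_neg]
  congr 1 with y
  rw [mul_neg, sin_neg]
  ring

theorem measurable_gammaIntegrand (aP aM : ℝ) (z : ℂ) : Measurable (gammaIntegrand aP aM z) := by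
  unfold gammaIntegrand
  fun_prop

theorem measurable_gammaIntegrandDeriv (aP aM : ℝ) (z : ℂ) :
    Measurable (gammaIntegrandDeriv aP aM z) := by
  unfold gammaIntegrandDeriv
  fun_prop

theorem sinh_ofReal_ne_zero {p : ℝ} (hp : p ≠ 0) : sinh (p : ℂ) ≠ 0 := by
  exact_mod_cast Real.sinh_ne_zero.2 hp

theorem hasDerivAt_gammaIntegrand (aP aM : ℝ) (z : ℂ) {y : ℝ} (hy : y ≠ 0) :
    HasDerivAt (fun u => gammaIntegrand aP aM u y) (gammaIntegrandDeriv aP aM z y) z := by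
  have hy' : (y : ℂ) ≠ 0 := ofReal_ne_zero.2 hy
  have hlin : HasDerivAt (fun u : ℂ => 2 * (y : ℂ) * u) (2 * y) z := by
    simpa using (hasDerivAt_id z).const_mul (2 * (y : ℂ))
  refine (((hlin.csin.div_const _).sub ((hasDerivAt_id z).div_const _)).const_mul
    (1 / (y : ℂ))).congr_deriv ?_
  rw [gammaIntegrandDeriv]
  field_simp

theorem norm_cos_two_mul_sub_one_le {R b y : ℝ} (hy : 0 < y) {z : ℂ} (hR : ‖z‖ ≤ R)
    (hb : |z.im| ≤ b) :
    ‖cos (2 * y * z) - 1‖ ≤ 2 * y ^ 2 * R ^ 2 * Real.exp (2 * b * y) := by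
  have him : |(2 * y * z).im| ≤ 2 * b * y := by
    have : (2 * y * z).im = 2 * y * z.im := by simp
    rw [this, abs_mul, abs_of_pos (by positivity)]
    nlinarith
  calc _ ≤ ‖2 * y * z‖ ^ 2 / 2 * Real.exp |(2 * y * z).im| := norm_cos_sub_one_le _
    _ = 2 * y ^ 2 * ‖z‖ ^ 2 * Real.exp |(2 * y * z).im| := by
        simp only [norm_mul, Complex.norm_ofNat, norm_real, Real.norm_of_nonneg hy.le]
        ring
    _ ≤ _ := by gcongr

theorem norm_gammaIntegrandDeriv_le {a c R b y : ℝ} (ha : 0 < a) (hc : 0 < c) (hy : 0 < y) {z : ℂ}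
    (hR : ‖z‖ ≤ R) (hb : |z.im| ≤ b) :
    ‖gammaIntegrandDeriv a c z y‖ ≤
      2 * R ^ 2 / (a * c) * ((1 + 2 * (a * y)) * (1 + 2 * (c * y)) *
        Real.exp (-(a + c - 2 * b) * y)) +
      (2 * (a / c) * (1 + (a * y) ^ 2)⁻¹ + 2 * (c / a) * (1 + (c * y) ^ 2)⁻¹) := by
  have hay := mul_pos ha hy
  have hcy := mul_pos hc hy
  have := Real.sinh_pos_iff.2 hay
  have := Real.sinh_pos_iff.2 hcy
  have hsplit : gammaIntegrandDeriv a c z y =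
      (cos (2 * y * z) - 1) * ((Real.sinh (a * y))⁻¹ * (Real.sinh (c * y))⁻¹ : ℝ) +
      ((Real.sinh (a * y) * Real.sinh (c * y))⁻¹ - (a * y * (c * y))⁻¹ : ℝ) := by
    rw [gammaIntegrandDeriv]
    push_cast
    ring
  rw [hsplit]
  refine (norm_add_le _ _).trans (add_le_add ?_ ?_)
  · rw [norm_mul, norm_real, Real.norm_of_nonneg (by positivity)]
    calc _ ≤ 2 * y ^ 2 * R ^ 2 * Real.exp (2 * b * y) *
          (((a * y)⁻¹ * ((1 + 2 * (a * y)) * Real.exp (-(a * y)))) *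
            ((c * y)⁻¹ * ((1 + 2 * (c * y)) * Real.exp (-(c * y))))) := by
          gcongr
          exacts [norm_cos_two_mul_sub_one_le hy hR hb, inv_sinh_le hay, inv_sinh_le hcy]
      _ = 2 * R ^ 2 / (a * c) * ((1 + 2 * (a * y)) * (1 + 2 * (c * y)) *
          (Real.exp (2 * b * y) * Real.exp (-(a * y)) * Real.exp (-(c * y)))) := by field_simp
      _ = _ := by
          rw [← Real.exp_add, ← Real.exp_add]
          ring_nf
  · rw [norm_real, Real.norm_eq_abs]
    refine (abs_inv_sinh_mul_sinh_sub_le hay hcy).trans_eq ?_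
    rw [mul_div_mul_right _ _ hy.ne', mul_div_mul_right _ _ hy.ne']

theorem integrableOn_linear_mul_linear_mul_exp {m : ℝ} (hm : 0 < m) (p q : ℝ) :
    IntegrableOn (fun y : ℝ => (1 + p * y) * (1 + q * y) * Real.exp (-m * y)) (Ioi 0) := by
  have hmonomial (k : ℕ) : IntegrableOn (fun y : ℝ => y ^ k * Real.exp (-m * y)) (Ioi 0) := by
    simpa using integrableOn_rpow_mul_exp_neg_mul_rpow (s := k) (p := 1) (b := m)
      (by linarith [(Nat.cast_nonneg k : (0 : ℝ) ≤ k)]) one_pos hm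
  refine (((hmonomial 0).add ((hmonomial 1).const_mul (p + q))).add
    ((hmonomial 2).const_mul (p * q))).congr_fun (fun y _ => ?_) measurableSet_Ioi
  simp only [Pi.add_apply]
  ring

theorem exists_integrable_bound_gammaIntegrandDeriv {a c b : ℝ} (ha : 0 < a) (hc : 0 < c)
    (hb : b < (a + c) / 2) (R : ℝ) :
    ∃ bound : ℝ → ℝ, IntegrableOn bound (Ioi 0) ∧ ∀ z : ℂ, ‖z‖ ≤ R → |z.im| ≤ b →
      ∀ y ∈ Ioi (0 : ℝ), ‖gammaIntegrandDeriv a c z y‖ ≤ bound y := by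
  refine ⟨_, ?_, fun z hR hzb y hy => norm_gammaIntegrandDeriv_le ha hc hy hR hzb⟩
  have hexp : IntegrableOn (fun y : ℝ => (1 + 2 * (a * y)) * (1 + 2 * (c * y)) *
      Real.exp (-(a + c - 2 * b) * y)) (Ioi 0) := by
    simpa only [mul_assoc] using integrableOn_linear_mul_linear_mul_exp (m := a + c - 2 * b)
      (by linarith) (2 * a) (2 * c)
  have hrational {p : ℝ} (hp : 0 < p) : IntegrableOn (fun y : ℝ => (1 + (p * y) ^ 2)⁻¹) (Ioi 0) :=
    (integrable_inv_one_add_sq.comp_mul_left' hp.ne').integrableOn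
  exact (hexp.const_mul _).add (((hrational ha).const_mul _).add ((hrational hc).const_mul _))

theorem integrableOn_gammaIntegrand {a c : ℝ} (ha : 0 < a) (hc : 0 < c) {z : ℂ}
    (hz : |z.im| < (a + c) / 2) : IntegrableOn (gammaIntegrand a c z) (Ioi 0) := by
  obtain ⟨bound, hbound_int, hbound⟩ :=
    exists_integrable_bound_gammaIntegrandDeriv ha hc hz ‖z‖
  have hconvex : Convex ℝ {u : ℂ | ‖u‖ ≤ ‖z‖ ∧ |u.im| ≤ |z.im|} := by
    have hball : Convex ℝ {u : ℂ | ‖u‖ ≤ ‖z‖} := by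
      simpa [Metric.closedBall] using convex_closedBall (0 : ℂ) ‖z‖
    simp only [abs_le]
    exact hball.inter ((convex_Icc (-|z.im|) |z.im|).linear_preimage imLm)
  refine (hbound_int.mul_const ‖z‖).mono' (measurable_gammaIntegrand a c z).aestronglyMeasurable
    ((ae_restrict_iff' measurableSet_Ioi).2 (.of_forall fun y hy => ?_))
  have hmean := hconvex.norm_image_sub_le_of_norm_hasDerivWithin_le (x := 0) (y := z)
    (fun u _ => (hasDerivAt_gammaIntegrand a c u (ne_of_gt hy)).hasDerivWithinAt)
    (fun u hu => hbound u hu.1 hu.2 y hy) (by simp) (by simp)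
  simpa [gammaIntegrand] using hmean

theorem hasDerivAt_gammaPhase {a c : ℝ} (ha : 0 < a) (hc : 0 < c) {z : ℂ}
    (hz : |z.im| < (a + c) / 2) :
    IntegrableOn (gammaIntegrandDeriv a c z) (Ioi 0) ∧
      HasDerivAt (gammaPhase a c) (∫ y in Ioi (0 : ℝ), gammaIntegrandDeriv a c z y) z := by
  obtain ⟨b, hzb, hb⟩ := exists_between hz
  obtain ⟨bound, hbound_int, hbound⟩ :=
    exists_integrable_bound_gammaIntegrandDeriv ha hc hb (‖z‖ + 1)
  have hbox : {u : ℂ | ‖u‖ ≤ ‖z‖ + 1 ∧ |u.im| ≤ b} ∈ 𝓝 z :=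
    Filter.inter_mem (continuous_norm.continuousAt.eventually_le_const (lt_add_one _))
      ((eventually_abs_im_lt hzb).mono fun _ => le_of_lt)
  exact hasDerivAt_integral_of_dominated_loc_of_deriv_le hbox
    (.of_forall fun u => (measurable_gammaIntegrand a c u).aestronglyMeasurable)
    (integrableOn_gammaIntegrand ha hc hz)
    (measurable_gammaIntegrandDeriv a c z).aestronglyMeasurable
    ((ae_restrict_iff' measurableSet_Ioi).2 (.of_forall fun y hy u hu => hbound u hu.1 hu.2 y hy))
    hbound_int ((ae_restrict_iff' measurableSet_Ioi).2 (.of_forall fun y hy u _ =>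
      hasDerivAt_gammaIntegrand a c u (ne_of_gt hy)))

end GammaPhase

section CoshPhase

/-- The integrand of `coshPhase`. -/
def coshIntegrand (z : ℂ) (y : ℝ) : ℂ := 1 / y * (1 / y - cos (2 * y * z) / sinh y)

/-- The increment of `I * gammaPhase` across a full period, after rescaling; it is a logarithm of
`2 * cosh (π * z)` on the strip `|Im z| < 1 / 2`. -/
def coshPhase (z : ℂ) : ℂ := ∫ y in Ioi (0 : ℝ), coshIntegrand z y

/-- The derivative of `coshIntegrand` in the complex variable; its integral is
`π * tanh (π * z)`. -/
def tanhIntegrand (z : ℂ) (y : ℝ) : ℂ := 2 * sin (2 * y * z) / sinh y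

theorem abs_im_add_half_lt {b : ℝ} {z : ℂ} (hz : |z.im| < b / 2) {c : ℝ} (hc : 0 < c) :
    |(z + I * c / 2).im| < (b + c) / 2 := by
  have him : (z + I * c / 2).im = z.im + c / 2 := by simp
  rw [him, abs_lt]
  constructor <;> linarith [(abs_lt.1 hz).1, (abs_lt.1 hz).2]

theorem abs_im_sub_half_lt {b : ℝ} {z : ℂ} (hz : |z.im| < b / 2) {c : ℝ} (hc : 0 < c) :
    |(z - I * c / 2).im| < (b + c) / 2 := by
  have him : (z - I * c / 2).im = z.im - c / 2 := by simp
  rw [him, abs_lt]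
  constructor <;> linarith [(abs_lt.1 hz).1, (abs_lt.1 hz).2]

theorem gammaIntegrand_sub {a c : ℝ} (ha : 0 < a) (hc : 0 < c) (z : ℂ) {y : ℝ} (hy : 0 < y) :
    I * (gammaIntegrand a c (z + I * c / 2) y - gammaIntegrand a c (z - I * c / 2) y) =
      a * coshIntegrand (z / a) (a * y) := by
  have ha' : (a : ℂ) ≠ 0 := ofReal_ne_zero.2 ha.ne'
  have hc' : (c : ℂ) ≠ 0 := ofReal_ne_zero.2 hc.ne'
  have hy' : (y : ℂ) ≠ 0 := ofReal_ne_zero.2 hy.ne'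
  have hsa : sinh (y * a : ℂ) ≠ 0 := by exact_mod_cast sinh_ofReal_ne_zero (mul_pos hy ha).ne'
  have hsc : sinh (y * c : ℂ) ≠ 0 := by exact_mod_cast sinh_ofReal_ne_zero (mul_pos hy hc).ne'
  have hadd : 2 * y * (z + I * c / 2) = 2 * y * z + c * y * I := by ring
  have hsub : 2 * y * (z - I * c / 2) = 2 * y * z - c * y * I := by ring
  have hscale : 2 * (a * y) * (z / a) = 2 * y * z := by field_simp
  rw [gammaIntegrand, gammaIntegrand, coshIntegrand, hadd, hsub, ofReal_mul, hscale, sin_add,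
    sin_sub, cos_mul_I, sin_mul_I]
  field_simp
  linear_combination (2 * c * sinh (y * c) * (y * a * cos (y * 2 * z) - sinh (y * a))) * I_sq

theorem gammaPhase_sub {a c : ℝ} (ha : 0 < a) (hc : 0 < c) {z : ℂ} (hz : |z.im| < a / 2) :
    I * (gammaPhase a c (z + I * c / 2) - gammaPhase a c (z - I * c / 2)) = coshPhase (z / a) := by
  calc I * (gammaPhase a c (z + I * c / 2) - gammaPhase a c (z - I * c / 2))
      = ∫ y in Ioi (0 : ℝ),
          I * (gammaIntegrand a c (z + I * c / 2) y - gammaIntegrand a c (z - I * c / 2) y) := by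
        rw [integral_const_mul, integral_sub
          (integrableOn_gammaIntegrand ha hc (abs_im_add_half_lt hz hc))
          (integrableOn_gammaIntegrand ha hc (abs_im_sub_half_lt hz hc))]
        rfl
    _ = a * ∫ y in Ioi (0 : ℝ), coshIntegrand (z / a) (a * y) := by
        rw [setIntegral_congr_fun measurableSet_Ioi fun y hy => gammaIntegrand_sub ha hc z hy,
          integral_const_mul]
    _ = coshPhase (z / a) := by
        rw [integral_comp_mul_left_Ioi _ _ ha, mul_zero, coshPhase, real_smul, ← mul_assoc,
          ofReal_inv, mul_inv_cancel₀ (ofReal_ne_zero.2 ha.ne'), one_mul]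

theorem gammaIntegrandDeriv_sub (z : ℂ) {y : ℝ} (hy : y ≠ 0) :
    I * (gammaIntegrandDeriv 1 1 (z + I / 2) y - gammaIntegrandDeriv 1 1 (z - I / 2) y) =
      tanhIntegrand z y := by
  have hs : sinh (y : ℂ) ≠ 0 := sinh_ofReal_ne_zero hy
  have hadd : 2 * y * (z + I / 2) = 2 * y * z + y * I := by ring
  have hsub : 2 * y * (z - I / 2) = 2 * y * z - y * I := by ring
  rw [gammaIntegrandDeriv, gammaIntegrandDeriv, tanhIntegrand, hadd, hsub, cos_add, cos_sub,
    sin_mul_I, ofReal_one, one_mul, one_mul]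
  field_simp
  linear_combination (-2 * sin (2 * y * z) * sinh y) * I_sq

theorem hasDerivAt_coshPhase {z : ℂ} (hz : |z.im| < 1 / 2) :
    IntegrableOn (tanhIntegrand z) (Ioi 0) ∧
      HasDerivAt coshPhase (∫ y in Ioi (0 : ℝ), tanhIntegrand z y) z := by
  have hplus := abs_im_add_half_lt hz one_pos
  have hminus := abs_im_sub_half_lt hz one_pos
  rw [ofReal_one, mul_one] at hplus hminus
  obtain ⟨hint_plus, hderiv_plus⟩ := hasDerivAt_gammaPhase one_pos one_pos hplus
  obtain ⟨hint_minus, hderiv_minus⟩ := hasDerivAt_gammaPhase one_pos one_pos hminus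
  have hcongr : EqOn (fun y => I * (gammaIntegrandDeriv 1 1 (z + I / 2) y -
      gammaIntegrandDeriv 1 1 (z - I / 2) y)) (tanhIntegrand z) (Ioi 0) :=
    fun y hy => gammaIntegrandDeriv_sub z (ne_of_gt hy)
  refine ⟨IntegrableOn.congr_fun ((hint_plus.sub hint_minus).const_mul I) hcongr
    measurableSet_Ioi, ?_⟩
  rw [← setIntegral_congr_fun measurableSet_Ioi hcongr, integral_const_mul,
    integral_sub hint_plus hint_minus]
  refine (((hderiv_plus.comp_add_const z _).sub (hderiv_minus.comp_sub_const z _)).const_mul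
    I).congr_of_eventuallyEq ?_
  filter_upwards [eventually_abs_im_lt hz] with u hu
  simpa using (gammaPhase_sub one_pos one_pos hu).symm

theorem two_mul_coshPhase_I_div_four : 2 * coshPhase (I / 4) = coshPhase 0 := by
  have hdouble : ∀ y ∈ Ioi (0 : ℝ), 2 * coshIntegrand (I / 4) y =
      1 / 2 * coshIntegrand 0 (1 / 2 * y) := by
    intro y hy
    obtain ⟨x, rfl⟩ : ∃ x : ℝ, y = 2 * x := ⟨y / 2, by ring⟩
    have hx : 0 < x := by simpa using hy
    have hhalf : (1 / 2 : ℝ) * (2 * x) = x := by ring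
    have hx' : (x : ℂ) ≠ 0 := ofReal_ne_zero.2 hx.ne'
    have hs : sinh (x : ℂ) ≠ 0 := sinh_ofReal_ne_zero hx.ne'
    have hc : cosh (x : ℂ) ≠ 0 := by exact_mod_cast (Real.cosh_pos x).ne'
    have harg : 2 * ((2 * x : ℝ) : ℂ) * (I / 4) = x * I := by
      push_cast
      ring
    rw [coshIntegrand, coshIntegrand, harg, hhalf, mul_zero, cos_zero, cos_mul_I,
      ofReal_mul, ofReal_ofNat, sinh_two_mul]
    field_simp
  rw [coshPhase, ← integral_const_mul, setIntegral_congr_fun measurableSet_Ioi hdouble,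
    integral_const_mul, integral_comp_mul_left_Ioi _ _ (by norm_num), mul_zero, coshPhase,
    real_smul, ← mul_assoc]
  norm_num

theorem integral_sin_mul_exp_neg {c : ℝ} {w : ℂ} (hw : |w.im| < c) :
    ∫ y in Ioi (0 : ℝ), sin (w * y) * Real.exp (-c * y) = w / (c ^ 2 + w ^ 2) := by
  obtain ⟨hlow, hup⟩ := abs_lt.1 hw
  have hminus : (-c - I * w).re < 0 := by
    have hre : (-c - I * w).re = -c + w.im := by simp
    linarith
  have hplus : (-c + I * w).re < 0 := by
    have hre : (-c + I * w).re = -c - w.im := by simp [sub_eq_add_neg]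
    linarith
  have hexpand (y : ℝ) : sin (w * y) * Real.exp (-c * y) =
      I / 2 * (exp ((-c - I * w) * y) - exp ((-c + I * w) * y)) := by
    have harg_minus : (-c - I * w) * y = -(w * y) * I + -c * y := by ring
    have harg_plus : (-c + I * w) * y = w * y * I + -c * y := by ring
    rw [sin, harg_minus, harg_plus, exp_add, exp_add]
    push_cast
    ring
  have hminus0 : -c - I * w ≠ 0 := fun h => hminus.ne (by rw [h, zero_re])
  have hplus0 : -c + I * w ≠ 0 := fun h => hplus.ne (by rw [h, zero_re])
  have hden : (c : ℂ) ^ 2 + w ^ 2 = (-c - I * w) * (-c + I * w) := by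
    linear_combination w ^ 2 * I_sq
  simp only [hexpand]
  rw [integral_const_mul, integral_sub (integrableOn_exp_mul_complex_Ioi hminus 0)
    (integrableOn_exp_mul_complex_Ioi hplus 0), integral_exp_mul_complex_Ioi hminus,
    integral_exp_mul_complex_Ioi hplus, hden, ofReal_zero, mul_zero, mul_zero, exp_zero]
  field_simp
  linear_combination (-2 * w) * I_sq

theorem hasSum_exp_neg_odd_mul {y : ℝ} (hy : 0 < y) :
    HasSum (fun k : ℕ => Real.exp (-(2 * k + 1) * y)) (2 * Real.sinh y)⁻¹ := by
  have hlt : Real.exp (-2 * y) < 1 := Real.exp_lt_one_iff.2 (by linarith)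
  have hgeom := (hasSum_geometric_of_lt_one (Real.exp_nonneg _) hlt).mul_left (Real.exp (-y))
  have hvalue : Real.exp (-y) * (1 - Real.exp (-2 * y))⁻¹ = (2 * Real.sinh y)⁻¹ := by
    have hfactor : 1 - Real.exp (-2 * y) = Real.exp (-y) * (2 * Real.sinh y) := by
      rw [Real.sinh_eq, mul_div_cancel₀ _ two_ne_zero, mul_sub, ← Real.exp_add, ← Real.exp_add,
        neg_add_cancel, Real.exp_zero]
      ring_nf
    rw [hfactor, mul_inv, mul_inv_cancel_left₀ (Real.exp_ne_zero _)]
  rw [hvalue] at hgeom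
  refine hgeom.congr_fun fun k => ?_
  rw [← Real.exp_nat_mul, ← Real.exp_add]
  ring_nf

theorem integral_sin_mul_exp_neg_odd_mul {z : ℂ} (hz : |z.im| < 1 / 2) (k : ℕ) :
    ∫ y in Ioi (0 : ℝ), 4 * sin (2 * y * z) * Real.exp (-(2 * k + 1) * y) =
      8 * z / ((2 * k + 1) ^ 2 + (2 * z) ^ 2) := by
  have hk : |(2 * z).im| < 2 * k + 1 := by
    have him : (2 * z).im = 2 * z.im := by simp
    rw [him, abs_mul, abs_two]
    linarith [(Nat.cast_nonneg k : (0 : ℝ) ≤ k)]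
  have hint := congrArg (4 * ·) (integral_sin_mul_exp_neg hk)
  simp only [← integral_const_mul, ← mul_assoc, mul_right_comm 2 z] at hint
  rw [hint]
  push_cast
  ring

theorem hasSum_integral_tanhIntegrand {z : ℂ} (hz : |z.im| < 1 / 2) :
    HasSum (fun k : ℕ => 8 * z / ((2 * k + 1) ^ 2 + (2 * z) ^ 2))
      (∫ y in Ioi (0 : ℝ), tanhIntegrand z y) := by
  have hsum {y : ℝ} (hy : 0 < y) : HasSum (fun k : ℕ =>
      4 * sin (2 * y * z) * (Real.exp (-(2 * k + 1) * y) : ℂ)) (tanhIntegrand z y) := by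
    have hvalue : tanhIntegrand z y = 4 * sin (2 * y * z) * ((2 * Real.sinh y)⁻¹ : ℝ) := by
      rw [tanhIntegrand]
      push_cast
      ring
    rw [hvalue]
    exact (hasSum_ofReal.2 (hasSum_exp_neg_odd_mul hy)).mul_left _
  have hnorm {y : ℝ} (hy : 0 < y) : HasSum (fun k : ℕ =>
      ‖4 * sin (2 * y * z) * (Real.exp (-(2 * k + 1) * y) : ℂ)‖) ‖tanhIntegrand z y‖ := by
    simp only [norm_mul _ (ofReal _), norm_real, Real.norm_of_nonneg (Real.exp_nonneg _)]
    have hvalue : ‖tanhIntegrand z y‖ = ‖4 * sin (2 * y * z)‖ * (2 * Real.sinh y)⁻¹ := by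
      rw [tanhIntegrand, ← ofReal_sinh, norm_div, norm_real,
        Real.norm_of_nonneg (Real.sinh_pos_iff.2 hy).le]
      simp only [norm_mul, Complex.norm_ofNat]
      ring
    rw [hvalue]
    exact (hasSum_exp_neg_odd_mul hy).mul_left _
  simp only [← integral_sin_mul_exp_neg_odd_mul hz]
  refine hasSum_integral_of_dominated_convergence
    (fun k y => ‖4 * sin (2 * y * z) * (Real.exp (-(2 * k + 1) * y) : ℂ)‖)
    (fun k => ?_) (fun k => .of_forall fun y => le_rfl) ?_ ?_ ?_
  · exact Continuous.aestronglyMeasurable (by fun_prop)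
  · filter_upwards [ae_restrict_mem measurableSet_Ioi] with y hy using (hnorm hy).summable
  · refine (hasDerivAt_coshPhase hz).1.norm.congr ?_
    filter_upwards [ae_restrict_mem measurableSet_Ioi] with y hy using (hnorm hy).tsum_eq.symm
  · filter_upwards [ae_restrict_mem measurableSet_Ioi] with y hy using hsum hy

theorem half_add_mul_I_mem_integerComplement {z : ℂ} (hz : |z.im| < 1 / 2) :
    1 / 2 + z * I ∈ integerComplement := by
  obtain ⟨hlow, hup⟩ := abs_lt.1 hz
  rintro ⟨n, hn⟩
  have hre : (n : ℝ) = 1 / 2 - z.im := by simpa [sub_eq_add_neg] using congrArg re hn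
  have hpos : (0 : ℝ) < n := by linarith
  have hlt : (n : ℝ) < 1 := by linarith
  norm_cast at hpos hlt
  omega

theorem sum_range_cotTerm_half_add (x : ℂ) (N : ℕ) :
    1 / (1 / 2 + x) + ∑ j ∈ Finset.range N, cotTerm (1 / 2 + x) j =
      ∑ k ∈ Finset.range N, (1 / (1 / 2 + x + k) - 1 / (1 / 2 - x + k)) + 1 / (1 / 2 + x + N) := by
  induction N with
  | zero => simp
  | succ N ih =>
    have hneg : 1 / 2 + x - (N + 1) = -(1 / 2 - x + N) := by ring
    rw [Finset.sum_range_succ, ← add_assoc, ih, Finset.sum_range_succ, cotTerm, hneg]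
    push_cast
    rw [div_neg]
    ring

theorem tendsto_sum_pi_mul_tan {x : ℂ} (hx : 1 / 2 + x ∈ integerComplement) :
    Tendsto (fun N : ℕ => ∑ k ∈ Finset.range N, (1 / (1 / 2 - x + k) - 1 / (1 / 2 + x + k))) atTop
      (𝓝 (Real.pi * tan (Real.pi * x))) := by
  have hremainder : Tendsto (fun N : ℕ => 1 / (1 / 2 + x + N)) atTop (𝓝 0) := by
    simp only [one_div]
    exact tendsto_inv₀_cobounded.comp
      ((tendsto_const_add_cobounded _).comp tendsto_natCast_atTop_cobounded)
  have hcot : cot (Real.pi * (1 / 2 + x)) = -tan (Real.pi * x) := by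
    have harg : Real.pi * (1 / 2 + x) = Real.pi * x + Real.pi / 2 := by ring
    rw [harg, cot_eq_cos_div_sin, cos_add_pi_div_two, sin_add_pi_div_two, tan_eq_sin_div_cos,
      neg_div]
  have hlim := hremainder.sub ((tendsto_logDeriv_euler_cot_sub hx).const_add (1 / (1 / 2 + x)))
  rw [add_sub_cancel, hcot, zero_sub, mul_neg, neg_neg] at hlim
  refine hlim.congr fun N => ?_
  rw [sum_range_cotTerm_half_add, sub_add_cancel_right, ← Finset.sum_neg_distrib]
  simp only [neg_sub]

theorem integral_tanhIntegrand {z : ℂ} (hz : |z.im| < 1 / 2) :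
    ∫ y in Ioi (0 : ℝ), tanhIntegrand z y = Real.pi * tanh (Real.pi * z) := by
  have hlim := (tendsto_sum_pi_mul_tan (half_add_mul_I_mem_integerComplement hz)).const_mul (-I)
  have hvalue : -I * (Real.pi * tan (Real.pi * (z * I))) = Real.pi * tanh (Real.pi * z) := by
    rw [← mul_assoc (Real.pi : ℂ) z, tan_mul_I]
    linear_combination (-Real.pi * tanh (Real.pi * z)) * I_sq
  rw [hvalue] at hlim
  refine tendsto_nhds_unique (hasSum_integral_tanhIntegrand hz).tendsto_sum_nat
    (hlim.congr fun N => ?_)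
  obtain ⟨hlow, hup⟩ := abs_lt.1 hz
  rw [Finset.mul_sum]
  refine Finset.sum_congr rfl fun k _ => ?_
  have := (Nat.cast_nonneg k : (0 : ℝ) ≤ k)
  have hminus : 1 / 2 - z * I + k ≠ 0 := fun h => by
    have : (1 / 2 : ℝ) + z.im + k = 0 := by simpa using congrArg re h
    linarith
  have hplus : 1 / 2 + z * I + k ≠ 0 := fun h => by
    have : (1 / 2 : ℝ) - z.im + k = 0 := by simpa [sub_eq_add_neg] using congrArg re h
    linarith
  have hden : (2 * k + 1 : ℂ) ^ 2 + (2 * z) ^ 2 =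
      4 * ((1 / 2 - z * I + k) * (1 / 2 + z * I + k)) := by
    linear_combination 4 * z ^ 2 * I_sq
  rw [hden, div_sub_div _ _ hminus hplus, mul_div_assoc', div_eq_div_iff
    (mul_ne_zero hminus hplus) (mul_ne_zero (by norm_num) (mul_ne_zero hminus hplus))]
  linear_combination (-8 * z * (1 / 2 - z * I + k) * (1 / 2 + z * I + k)) * I_sq

theorem cosh_pi_mul_ne_zero {z : ℂ} (hz : |z.im| < 1 / 2) : cosh (Real.pi * z) ≠ 0 := by
  have hsin : sin (Real.pi * (1 / 2 + z * I)) = cosh (Real.pi * z) := by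
    have harg : Real.pi * (1 / 2 + z * I) = Real.pi * z * I + Real.pi / 2 := by ring
    rw [harg, sin_add_pi_div_two, cos_mul_I]
  exact hsin ▸ sin_pi_mul_ne_zero (half_add_mul_I_mem_integerComplement hz)

theorem exp_neg_coshPhase_mul_cosh {z : ℂ} (hz : |z.im| < 1 / 2) :
    exp (-coshPhase z) * cosh (Real.pi * z) = exp (-coshPhase 0) := by
  have hderiv {x : ℂ} (hx : |x.im| < 1 / 2) :
      HasDerivAt (fun u => exp (-coshPhase u) * cosh (Real.pi * u)) 0 x := by
    have hphase := (hasDerivAt_coshPhase hx).2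
    rw [integral_tanhIntegrand hx] at hphase
    have hlin : HasDerivAt (fun u : ℂ => Real.pi * u) Real.pi x := by
      simpa using (hasDerivAt_id x).const_mul (Real.pi : ℂ)
    refine (hphase.fun_neg.cexp.fun_mul hlin.ccosh).congr_deriv ?_
    rw [tanh_eq_sinh_div_cosh]
    field_simp [cosh_pi_mul_ne_zero hx]
    ring
  have hopen : IsOpen {u : ℂ | |u.im| < 1 / 2} := isOpen_lt (by fun_prop) continuous_const
  have hconvex : Convex ℝ {u : ℂ | |u.im| < 1 / 2} := by
    simp only [abs_lt]
    exact (convex_Ioo (-(1 / 2)) (1 / 2)).linear_preimage imLm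
  have hconst := hopen.is_const_of_deriv_eq_zero hconvex.isPreconnected
    (fun x hx => (hderiv hx).differentiableAt.differentiableWithinAt)
    (fun x hx => (hderiv hx).deriv) hz (by simp : (0 : ℂ) ∈ {u : ℂ | |u.im| < 1 / 2})
  simpa using hconst

theorem exp_coshPhase_zero : exp (coshPhase 0) = 2 := by
  have hquarter : |(I / 4).im| < 1 / 2 := by norm_num [abs_lt]
  have hcosh : cosh (Real.pi * (I / 4)) ^ 2 = 1 / 2 := by
    have harg : (Real.pi * (I / 4) : ℂ) = (Real.pi / 4 : ℝ) * I := by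
      push_cast
      ring
    rw [harg, cosh_mul_I, ← ofReal_cos, ← ofReal_pow, Real.cos_pi_div_four, div_pow,
      Real.sq_sqrt zero_le_two]
    norm_num
  have hsq := congrArg (· ^ 2) (exp_neg_coshPhase_mul_cosh hquarter)
  simp only [mul_pow, hcosh, ← exp_nat_mul, Nat.cast_ofNat, mul_neg,
    two_mul_coshPhase_I_div_four, two_mul (coshPhase 0), exp_add, neg_add] at hsq
  have := exp_ne_zero (-coshPhase 0)
  have hinv : exp (-coshPhase 0) = 1 / 2 := mul_left_cancel₀ this hsq.symm
  rw [← neg_neg (coshPhase 0), exp_neg, hinv, one_div, inv_inv]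

theorem exp_coshPhase {z : ℂ} (hz : |z.im| < 1 / 2) :
    exp (coshPhase z) = 2 * cosh (Real.pi * z) := by
  have hconst := exp_neg_coshPhase_mul_cosh hz
  rw [exp_neg, exp_neg, exp_coshPhase_zero, inv_mul_eq_iff_eq_mul₀ (exp_ne_zero _)] at hconst
  rw [hconst]
  ring

end CoshPhase

section HyperbolicGamma

theorem exp_gammaPhase_add {a c : ℝ} (ha : 0 < a) (hc : 0 < c) {u : ℂ}
    (hlow : -((a + c) / 2) < u.im) (hup : u.im + c < (a + c) / 2) :
    exp (I * gammaPhase a c (u + I * c)) =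
      2 * cosh (Real.pi * (u + I * c / 2) / a) * exp (I * gammaPhase a c u) := by
  have hmid : |(u + I * c / 2).im| < a / 2 := by
    have him : (u + I * c / 2).im = u.im + c / 2 := by simp
    rw [him, abs_lt]
    constructor <;> linarith
  have hscaled : |((u + I * c / 2) / a).im| < 1 / 2 := by
    rw [div_ofReal_im, abs_div, abs_of_pos ha, div_lt_iff₀ ha]
    linarith
  have hincrement : I * (gammaPhase a c (u + I * c) - gammaPhase a c u) =
      coshPhase ((u + I * c / 2) / a) := by
    rw [← gammaPhase_sub ha hc hmid, add_sub_cancel_right, add_assoc, add_halves]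
  rw [mul_div_assoc, ← exp_coshPhase hscaled, ← hincrement, ← exp_add]
  ring_nf

theorem stepCount_add {aP aM t : ℝ} (hM : 0 < aM) (ht : (aP + aM) / 2 ≤ t + aM) :
    stepCount aP aM (t + aM) = stepCount aP aM t + 1 := by
  have hnonneg : 0 ≤ (t - (aP + aM) / 2) / aM + 1 := by
    rw [← div_self hM.ne', ← add_div]
    exact div_nonneg (by linarith) hM.le
  rw [stepCount, stepCount, ← Nat.floor_add_one hnonneg, add_sub_right_comm, add_div,
    div_self hM.ne']

theorem hyperbolicGamma_neg (aP aM : ℝ) (z : ℂ) :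
    hyperbolicGamma aP aM (-z) = (hyperbolicGamma aP aM z)⁻¹ := by
  have hphase (n m : ℕ) : -z - n * (I * aM) + m * (I * aM) =
      -(z - m * (I * aM) + n * (I * aM)) := by ring
  have hcosh_sub (t : ℂ) : cosh (Real.pi * (-z - t) / aP) = cosh (Real.pi * (z + t) / aP) := by
    rw [← cosh_neg]
    ring_nf
  have hcosh_add (t : ℂ) : cosh (Real.pi * (-z + t) / aP) = cosh (Real.pi * (z - t) / aP) := by
    rw [← cosh_neg]
    ring_nf
  simp only [hyperbolicGamma, neg_im, neg_neg, hphase, hcosh_sub, hcosh_add, gammaPhase_neg,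
    mul_neg, exp_neg]
  rw [inv_div, div_eq_mul_inv _ (exp _ * _), mul_inv, div_eq_mul_inv]
  ring

theorem hyperbolicGamma_add_right {aP aM : ℝ} (hP : 0 < aP) (hM : 0 < aM) {u : ℂ}
    (hu : -((aP + aM) / 2) < u.im) :
    hyperbolicGamma aP aM (u + I * aM) =
      2 * cosh (Real.pi * (u + I * aM / 2) / aP) * hyperbolicGamma aP aM u := by
  have him : (u + I * aM).im = u.im + aM := by simp
  rcases lt_or_ge (u.im + aM) ((aP + aM) / 2) with hup | hup
  · rw [hyperbolicGamma_eq_exp hM (by rw [him, abs_lt]; constructor <;> linarith),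
      hyperbolicGamma_eq_exp hM (by rw [abs_lt]; constructor <;> linarith)]
    exact exp_gammaPhase_add hP hM hu hup
  · have hcount : stepCount aP aM (-u.im) = 0 := stepCount_eq_zero hM (by linarith)
    have hcount_add : stepCount aP aM (-(u.im + aM)) = 0 := stepCount_eq_zero hM (by linarith)
    have hpoint (n : ℕ) : u + I * aM - ((n + 1 : ℕ) : ℂ) * (I * aM) = u - n * (I * aM) := by
      push_cast
      ring
    have hfirst : u + I * aM - (((0 : ℕ) : ℂ) + 1 / 2) * (I * aM) = u + I * aM / 2 := by
      push_cast
      ring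
    have hrest (j : ℕ) : u + I * aM - (((j + 1 : ℕ) : ℂ) + 1 / 2) * (I * aM) =
        u - (j + 1 / 2) * (I * aM) := by
      push_cast
      ring
    simp only [hyperbolicGamma, him, hcount, hcount_add, stepCount_add hM hup,
      Finset.prod_range_succ', Finset.range_zero, Finset.prod_empty, div_one, hpoint, hfirst, hrest]
    ring

theorem differentiableAt_hyperbolicGamma {aP aM : ℝ} (hP : 0 < aP) (hM : 0 < aM) {z : ℂ}
    (hz : -((aP + aM) / 2) < z.im) : DifferentiableAt ℂ (hyperbolicGamma aP aM) z := by
  obtain ⟨n, hn⟩ := exists_nat_gt ((z.im - (aP + aM) / 2) / aM)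
  rw [div_lt_iff₀ hM, sub_lt_iff_lt_add] at hn
  induction n generalizing z with
  | zero =>
    have hstrip : |z.im| < (aP + aM) / 2 := abs_lt.2 ⟨hz, by simpa using hn⟩
    refine (((hasDerivAt_gammaPhase hP hM hstrip).2.differentiableAt.const_mul I).cexp
      ).congr_of_eventuallyEq ?_
    filter_upwards [eventually_abs_im_lt hstrip] with u hu using hyperbolicGamma_eq_exp hM hu
  | succ n ih =>
    by_cases hlow : z.im < (aP + aM) / 2
    · exact ih hz (by nlinarith [(Nat.cast_nonneg n : (0 : ℝ) ≤ n)])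
    have him (u : ℂ) : (u - I * aM).im = u.im - aM := by simp
    push_cast at hn
    have hpred : -((aP + aM) / 2) < (z - I * aM).im := by
      rw [him]
      linarith
    have hdiff : DifferentiableAt ℂ (fun u => 2 * cosh (Real.pi * (u - I * aM + I * aM / 2) / aP) *
        hyperbolicGamma aP aM (u - I * aM)) z :=
      DifferentiableAt.mul (by fun_prop)
        (differentiableAt_comp_sub_const.2 (ih hpred (by rw [him]; linarith)))
    refine hdiff.congr_of_eventuallyEq ?_
    have hcont : Continuous fun u : ℂ => (u - I * aM).im := by fun_prop
    filter_upwards [hcont.continuousAt.eventually_const_lt hpred] with u hu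
    rw [← hyperbolicGamma_add_right hP hM hu, sub_add_cancel]

theorem hyperbolicGamma_comm {aP aM : ℝ} (hP : 0 < aP) (hM : 0 < aM) (z : ℂ) :
    hyperbolicGamma aP aM z = hyperbolicGamma aM aP z := by
  have hupper : EqOn (hyperbolicGamma aP aM) (hyperbolicGamma aM aP)
      {u | -((aP + aM) / 2) < u.im} := by
    have hopen : IsOpen {u : ℂ | -((aP + aM) / 2) < u.im} :=
      isOpen_lt continuous_const continuous_im
    have hzero : (0 : ℂ) ∈ {u : ℂ | -((aP + aM) / 2) < u.im} :=
      neg_neg_of_pos (by positivity : 0 < (aP + aM) / 2)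
    refine AnalyticOnNhd.eqOn_of_preconnected_of_eventuallyEq (z₀ := 0)
      (DifferentiableOn.analyticOnNhd (fun u hu =>
        (differentiableAt_hyperbolicGamma hP hM hu).differentiableWithinAt) hopen)
      (DifferentiableOn.analyticOnNhd (fun u hu => (differentiableAt_hyperbolicGamma hM hP
        (by rwa [add_comm])).differentiableWithinAt) hopen)
      (convex_halfSpace_im_gt _).isPreconnected hzero ?_
    have hstrip : |(0 : ℂ).im| < (aP + aM) / 2 := by
      rw [zero_im, abs_zero]
      positivity
    filter_upwards [eventually_abs_im_lt hstrip] with u hu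
    rw [hyperbolicGamma_eq_exp hM hu, hyperbolicGamma_eq_exp hP (by rwa [add_comm]),
      gammaPhase_comm]
  rcases lt_or_ge (-((aP + aM) / 2)) z.im with hz | hz
  · exact hupper hz
  · have hneg : -((aP + aM) / 2) < (-z).im := by
      rw [neg_im]
      linarith
    rw [← inv_inj, ← hyperbolicGamma_neg, ← hyperbolicGamma_neg, hupper hneg]

theorem mem_hyperbolicGammaPoles_of_cosh_eq_zero {aP aM : ℝ} (hP : 0 < aP) {u : ℂ}
    (hu : u.im ≤ -((aP + aM) / 2)) (hcosh : cosh (Real.pi * (u + I * aM / 2) / aP) = 0) :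
    u ∈ hyperbolicGammaPoles aP aM := by
  rw [← cos_mul_I, cos_eq_zero_iff] at hcosh
  obtain ⟨k, hk⟩ := hcosh
  have hP' : (aP : ℂ) ≠ 0 := ofReal_ne_zero.2 hP.ne'
  have huk : u = -I * ((aP + aM) / 2 + k * aP) := by
    field_simp at hk
    linear_combination (-I / 2) * hk + (u + I * aM / 2) * I_sq
  have him : u.im = -((aP + aM) / 2 + k * aP) := by
    rw [huk]
    exact_mod_cast by simp
  have hk0 : (0 : ℝ) ≤ k := by
    by_contra! hneg
    linarith [mul_neg_of_neg_of_pos hneg hP]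
  lift k to ℕ using by exact_mod_cast hk0
  exact ⟨k, 0, by simpa using huk⟩

theorem hyperbolicGamma_add_right_of_notMem_poles {aP aM : ℝ} (hP : 0 < aP) (hM : 0 < aM) {u : ℂ}
    (hu : u ∉ hyperbolicGammaPoles aP aM) :
    hyperbolicGamma aP aM (u + I * aM) =
      2 * cosh (Real.pi * (u + I * aM / 2) / aP) * hyperbolicGamma aP aM u := by
  rcases lt_or_ge (-((aP + aM) / 2)) u.im with hupper | hlower
  · exact hyperbolicGamma_add_right hP hM hupper
  have hcosh : cosh (Real.pi * (u + I * aM / 2) / aP) ≠ 0 :=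
    fun h => hu (mem_hyperbolicGammaPoles_of_cosh_eq_zero hP hlower h)
  have hreflect : -((aP + aM) / 2) < (-(u + I * aM)).im := by
    have him : (-(u + I * aM)).im = -(u.im + aM) := by simp
    rw [him]
    linarith
  have hstep := hyperbolicGamma_add_right hP hM hreflect
  have harg : Real.pi * (-(u + I * aM) + I * aM / 2) / aP =
      -(Real.pi * (u + I * aM / 2) / aP) := by ring
  rw [neg_add, neg_add_cancel_right, ← neg_add, harg, cosh_neg, hyperbolicGamma_neg,
    hyperbolicGamma_neg] at hstep
  rw [← inv_inj, mul_inv, hstep, inv_mul_cancel_left₀]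
  exact mul_ne_zero two_ne_zero hcosh

end HyperbolicGamma

section KernelIdentity

/-- The factor of `kernelS3` attached to `z = v_k + w_l`. -/
def pairGamma (aP aM : ℝ) (d z : ℂ) : ℂ :=
  hyperbolicGamma aP aM (z - I * (aP + aM) / 4 + d) *
    hyperbolicGamma aP aM (z - I * (aP + aM) / 4 - d)

theorem kernelS3_eq_prod_pairGamma (aP aM : ℝ) (d : ℂ) (v w : Fin 4 → ℂ) :
    kernelS3 aP aM d v w = ∏ k, ∏ l, pairGamma aP aM d (v k + w l) := rfl

theorem kernelS3_comm {aP aM : ℝ} (hP : 0 < aP) (hM : 0 < aM) (d : ℂ) (v w : Fin 4 → ℂ) :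
    kernelS3 aP aM d v w = kernelS3 aM aP d v w := by
  simp only [kernelS3, hyperbolicGamma_comm hP hM, add_comm (aP : ℂ)]

theorem hyperbolicGammaPoles_comm (aP aM : ℝ) :
    hyperbolicGammaPoles aP aM = hyperbolicGammaPoles aM aP := by
  ext z
  constructor <;> rintro ⟨m, n, rfl⟩ <;> exact ⟨n, m, by ring⟩

theorem IsRegularPoint.swap {aP aM α β : ℝ} {d : ℂ} {v w : Fin 4 → ℂ}
    (h : IsRegularPoint aP aM α β d v w) : IsRegularPoint aM aP α β d v w where
  left_ne := h.left_ne
  right_ne := h.right_ne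
  not_pole_add := by simpa only [add_comm (aP : ℂ), hyperbolicGammaPoles_comm] using h.not_pole_add
  not_pole_sub := by simpa only [add_comm (aP : ℂ), hyperbolicGammaPoles_comm] using h.not_pole_sub

theorem pairGamma_shift {aP aM : ℝ} (hP : 0 < aP) (hM : 0 < aM) {d z : ℂ}
    (hadd : z - I * (aP + aM) / 4 - I * aM / 4 + d ∉ hyperbolicGammaPoles aP aM)
    (hsub : z - I * (aP + aM) / 4 - I * aM / 4 - d ∉ hyperbolicGammaPoles aP aM) :
    pairGamma aP aM d (z + 3 * (I * aM / 4)) =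
      stepFactor aP d z * pairGamma aP aM d (z - I * aM / 4) := by
  have hstep {s : ℂ} (hs : z - I * (aP + aM) / 4 - I * aM / 4 + s ∉ hyperbolicGammaPoles aP aM) :
      hyperbolicGamma aP aM (z + 3 * (I * aM / 4) - I * (aP + aM) / 4 + s) =
        2 * cosh (Real.pi * (z - I * aP / 4 + s) / aP) *
          hyperbolicGamma aP aM (z - I * aM / 4 - I * (aP + aM) / 4 + s) := by
    have hG := hyperbolicGamma_add_right_of_notMem_poles hP hM hs
    ring_nf at hG ⊢
    exact hG
  rw [sub_eq_add_neg _ d] at hsub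
  simp only [pairGamma, stepFactor, sub_eq_add_neg _ d, hstep hadd, hstep hsub]
  ring

theorem kernel_identity {aP aM : ℝ} (hP : 0 < aP) (hM : 0 < aM) {d : ℂ} {v w : Fin 4 → ℂ}
    (hv : ∑ j, v j = 0) (hw : ∑ j, w j = 0) (h : IsRegularPoint aP aM aP aM d v w) :
    opA3 aP aM (fun x => kernelS3 aP aM d x w) v =
      opA3 aP aM (fun x => kernelS3 aP aM d v x) w := by
  simp only [kernelS3_eq_prod_pairGamma]
  exact opA3_prod_prod_eq hP.ne' hv hw h.left_ne h.right_ne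
    fun k l => pairGamma_shift hP hM (h.not_pole_add k l) (h.not_pole_sub k l)

end KernelIdentity

end A3Kernel

end

theorem theorem3p3 (aP aM : ℝ) (haP : 0 < aP) (haM : 0 < aM) (d : ℂ) (v w : Fin 4 → ℂ)
    (hv : ∑ j, v j = 0) (hw : ∑ j, w j = 0) :
    (A3Kernel.IsRegularPoint aP aM aP aM d v w →
      A3Kernel.opA3 aP aM (fun x => A3Kernel.kernelS3 aP aM d x w) v =
        A3Kernel.opA3 aP aM (fun x => A3Kernel.kernelS3 aP aM d v x) w) ∧
    (A3Kernel.IsRegularPoint aP aM aM aP d v w →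
      A3Kernel.opA3 aM aP (fun x => A3Kernel.kernelS3 aP aM d x w) v =
        A3Kernel.opA3 aM aP (fun x => A3Kernel.kernelS3 aP aM d v x) w) := by
  refine ⟨A3Kernel.kernel_identity haP haM hv hw, fun h => ?_⟩
  simp only [A3Kernel.kernelS3_comm haP haM]
  exact A3Kernel.kernel_identity haM haP hv hw h.swap
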